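/- Let $S=K[x,y]$ be the polynomial ring in two variables over a field $K$ and let $\mathfrak m=(x,y)$. For an ideal $I$ of $S$ let $$\mathrm r(S/I)=\ell_S\bigl((I:_S\mathfrak m)/I\bigr)$$ denote the length of the socle of $S/I$ (the Cohen–Macaulay type of $S/I$ when $I$ is $\mathfrak m$-primary). A monomial ideal is an ideal generated by a set of monomials. Then the following hold. (a) Let $I$ be a monomial ideal of $S$. If $\mathrm r(S/I)\ge 5$, then $\mathrm r(S/I^2)\ge 8$. (b) For every positive integer $n$ there exists an $\mathfrak m$-primary monomial ideal $I$ of $S$ such that $$\mathrm r(S/I)>\mathrm r(S/I^2)>\cdots>\mathrm r(S/I^n)=(n+1)^2-1 .$$ -/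

import Mathlib

/-- The homogeneous maximal ideal `(x, y)` of `S = K[x, y]`, where `x = X 0` and `y = X 1`. -/
noncomputable def maxIdealXY (K : Type*) [Field K] : Ideal (MvPolynomial (Fin 2) K) :=
  Ideal.span {MvPolynomial.X 0, MvPolynomial.X 1}

/-- A monomial ideal of `K[x, y]`: an ideal generated by a set of monomials `x ^ (a 0) * y ^ (a 1)`. -/
def IsMonomialIdeal {K : Type*} [Field K] (I : Ideal (MvPolynomial (Fin 2) K)) : Prop :=
  ∃ A : Set (Fin 2 →₀ ℕ),
    I = Ideal.span ((fun a => MvPolynomial.monomial a (1 : K)) '' A)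

/-- `r(S/I) = ℓ_S((I :_S (x, y)) / I)`, the length of the socle of `S/I`. The quotient
`(I : (x, y)) / I` is realized as the image of `I : (x, y)` in `S/I`. -/
noncomputable def socleType {K : Type*} [Field K] (I : Ideal (MvPolynomial (Fin 2) K)) : ℕ∞ :=
  Module.length (MvPolynomial (Fin 2) K)
    (Submodule.map (Submodule.mkQ I)
      (Submodule.colon I (maxIdealXY K : Set (MvPolynomial (Fin 2) K))))

/-!
The socle of `S/I` for a monomial ideal `I` has a basis indexed by the inner corners of the
staircase of exponents of `I`, so for `I ≠ 0` its length is one less than the number of minimal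
generators. In particular it is at least `r` as soon as `I` contains monomials with exponents
`p₀, …, pᵣ` such that the lower left corner of the rectangle spanned by `pᵢ` and `pᵢ₊₁` is never
an exponent of `I`.

For (a), order the minimal generators `p₀, …, pₘ`, `5 ≤ m`, of `I` from left to right. Two or
three sums at either end of the staircase of `I ^ 2` always fit into such a sequence; the
remaining three members are chosen according to the position of `p₀ + pₘ` relative to the sums of
its neighbours.

For (b), place monomials in the cells of a coarse square grid, on the antidiagonal
`c₁ + c₂ = n + 2`: single ones in the two outermost cells at either end and rapidly growing
numbers of them in the cells between. In the `k`-th power the sums of the outer ones dominate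
everything which involves the cells with abscissa at most `k`. So passing to the next power
removes the contribution of the largest remaining cell, which exceeds all that is left, until only
the outer ones matter, and the `n`-th power is generated by the `n * (n + 2) + 1` grid points on
an antidiagonal.
-/

open MvPolynomial
open scoped Pointwise

/-- The exponent vector of the monomial `x ^ p.1 * y ^ p.2`. Exponents are handled as pairs, where
the coordinatewise order, sums and `Prod.swap` are at hand. -/
noncomputable def expVec : ℕ × ℕ ≃+ (Fin 2 →₀ ℕ) where
  toFun p := Finsupp.single 0 p.1 + Finsupp.single 1 p.2
  invFun u := (u 0, u 1)
  left_inv p := by simp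
  right_inv u := by ext i; fin_cases i <;> simp
  map_add' p q := by ext i; fin_cases i <;> simp

theorem expVec_symm_apply (u : Fin 2 →₀ ℕ) : expVec.symm u = (u 0, u 1) := rfl

theorem expVec_le_iff {p : ℕ × ℕ} {u : Fin 2 →₀ ℕ} : expVec p ≤ u ↔ p ≤ expVec.symm u := by
  simp [Finsupp.le_def, Fin.forall_fin_two, Prod.le_def, expVec]

section MonomialIdeals

variable {K : Type*} [Field K]

variable (K) in
/-- The ideal of `K[x, y]` generated by the monomials whose exponents lie in `P`. -/
noncomputable def monomialIdeal (P : Set (ℕ × ℕ)) : Ideal (MvPolynomial (Fin 2) K) :=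
  Ideal.span ((fun p => monomial (expVec p) 1) '' P)

theorem monomialIdeal_eq_span (P : Set (ℕ × ℕ)) :
    monomialIdeal K P = Ideal.span ((fun a => monomial a 1) '' (expVec '' P)) := by
  rw [monomialIdeal, Set.image_image]

theorem isMonomialIdeal_monomialIdeal (P : Set (ℕ × ℕ)) : IsMonomialIdeal (monomialIdeal K P) :=
  ⟨_, monomialIdeal_eq_span P⟩

theorem IsMonomialIdeal.exists_eq_monomialIdeal {I : Ideal (MvPolynomial (Fin 2) K)}
    (hI : IsMonomialIdeal I) : ∃ P, I = monomialIdeal K P := by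
  obtain ⟨A, rfl⟩ := hI
  exact ⟨expVec ⁻¹' A, by rw [monomialIdeal_eq_span, Set.image_preimage_eq _ expVec.surjective]⟩

theorem mem_monomialIdeal {P : Set (ℕ × ℕ)} {f : MvPolynomial (Fin 2) K} :
    f ∈ monomialIdeal K P ↔ ∀ u ∈ f.support, expVec.symm u ∈ upperClosure P := by
  simp only [monomialIdeal_eq_span, mem_ideal_span_monomial_image, Set.exists_mem_image,
    expVec_le_iff, mem_upperClosure]

theorem monomialIdeal_congr {P Q : Set (ℕ × ℕ)} (h : upperClosure P = upperClosure Q) :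
    monomialIdeal K P = monomialIdeal K Q := by
  ext f
  rw [mem_monomialIdeal, mem_monomialIdeal, h]

theorem monomialIdeal_mul (P Q : Set (ℕ × ℕ)) :
    monomialIdeal K P * monomialIdeal K Q = monomialIdeal K (P + Q) := by
  rw [monomialIdeal, monomialIdeal, Ideal.span_mul_span']
  refine congrArg Ideal.span (Set.image_image2_distrib fun p q => ?_).symm
  rw [map_add, monomial_mul, one_mul]

theorem monomialIdeal_pow (P : Set (ℕ × ℕ)) (n : ℕ) :
    monomialIdeal K P ^ n = monomialIdeal K (n • P) := by
  induction n with
  | zero => simp [monomialIdeal, ← Set.singleton_zero, Ideal.one_eq_top]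
  | succ n ih => rw [pow_succ, ih, monomialIdeal_mul, succ_nsmul]

theorem maxIdealXY_eq_ker_constantCoeff :
    maxIdealXY K = RingHom.ker (constantCoeff : MvPolynomial (Fin 2) K →+* K) := by
  have hspan : maxIdealXY K = Ideal.span (X '' (Set.univ : Set (Fin 2))) := by
    rw [maxIdealXY]
    congr 1
    ext
    simp [eq_comm]
  ext f
  rw [hspan, mem_ideal_span_X_image, RingHom.mem_ker, constantCoeff_eq, ← notMem_support_iff]
  refine ⟨fun h h0 => ?_, fun h u hu => ?_⟩
  · obtain ⟨i, -, hi⟩ := h 0 h0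
    exact hi rfl
  · obtain ⟨i, hi⟩ := Finsupp.ne_iff.1 (ne_of_mem_of_not_mem hu h)
    exact ⟨i, Set.mem_univ i, hi⟩

theorem radical_monomialIdeal {P : Set (ℕ × ℕ)} {a b : ℕ} (ha : (a, 0) ∈ P) (hb : (0, b) ∈ P)
    (h0 : 0 ∉ P) : (monomialIdeal K P).radical = maxIdealXY K := by
  apply le_antisymm
  · rw [maxIdealXY_eq_ker_constantCoeff, (RingHom.ker_isPrime _).radical_le_iff]
    intro f hf
    rw [RingHom.mem_ker, constantCoeff_eq, ← notMem_support_iff]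
    intro hmem
    obtain ⟨q, hq, hq0⟩ := mem_upperClosure.1 (mem_monomialIdeal.1 hf 0 hmem)
    rw [map_zero, nonpos_iff_eq_zero] at hq0
    exact h0 (hq0 ▸ hq)
  · rw [maxIdealXY, Ideal.span_le, Set.pair_subset_iff]
    refine ⟨⟨a, Ideal.subset_span ⟨_, ha, ?_⟩⟩, ⟨b, Ideal.subset_span ⟨_, hb, ?_⟩⟩⟩ <;>
      simp [expVec, X_pow_eq_monomial]

/-- The exponents of the monomials outside the monomial ideal with exponent set `U` which `x` and
`y` multiply into it. These monomials form a basis of the socle of the quotient. -/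
def socleSet (U : UpperSet (ℕ × ℕ)) : Set (ℕ × ℕ) :=
  {p | p ∉ U ∧ (p.1 + 1, p.2) ∈ U ∧ (p.1, p.2 + 1) ∈ U}

theorem mem_colon_maxIdealXY {I : Ideal (MvPolynomial (Fin 2) K)} {f : MvPolynomial (Fin 2) K} :
    f ∈ Submodule.colon I (maxIdealXY K : Set (MvPolynomial (Fin 2) K)) ↔
      f * X 0 ∈ I ∧ f * X 1 ∈ I := by
  rw [maxIdealXY, Submodule.colon_span]
  simp [Submodule.mem_colon]

theorem mem_colon_monomialIdeal {P : Set (ℕ × ℕ)} {f : MvPolynomial (Fin 2) K} :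
    f ∈ Submodule.colon (monomialIdeal K P) (maxIdealXY K : Set (MvPolynomial (Fin 2) K)) ↔
      ∀ u ∈ f.support, (u 0 + 1, u 1) ∈ upperClosure P ∧ (u 0, u 1 + 1) ∈ upperClosure P := by
  rw [mem_colon_maxIdealXY, mem_monomialIdeal, mem_monomialIdeal, support_mul_X, support_mul_X]
  simp [expVec_symm_apply, forall_and]

theorem restrictSupport_union {σ R : Type*} [CommSemiring R] (s t : Set (σ →₀ ℕ)) :
    restrictSupport R (s ∪ t) = restrictSupport R s ⊔ restrictSupport R t := by
  simp only [restrictSupport_eq_span, Set.image_union, Submodule.span_union]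

theorem disjoint_restrictSupport {σ R : Type*} [CommSemiring R] {s t : Set (σ →₀ ℕ)}
    (h : Disjoint s t) : Disjoint (restrictSupport R s) (restrictSupport R t) := by
  rw [Submodule.disjoint_def]
  intro f hs ht
  rw [← support_eq_empty, ← Finset.coe_eq_empty, ← Set.subset_empty_iff]
  exact h hs ht

theorem restrictScalars_monomialIdeal (P : Set (ℕ × ℕ)) :
    (monomialIdeal K P).restrictScalars K =
      restrictSupport K (expVec.symm ⁻¹' upperClosure P) := by
  ext
  exact mem_monomialIdeal

theorem restrictScalars_colon_monomialIdeal (P : Set (ℕ × ℕ)) :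
    (Submodule.colon (monomialIdeal K P)
        (maxIdealXY K : Set (MvPolynomial (Fin 2) K))).restrictScalars K =
      restrictSupport K (expVec.symm ⁻¹' socleSet (upperClosure P)) ⊔
        (monomialIdeal K P).restrictScalars K := by
  rw [restrictScalars_monomialIdeal, ← restrictSupport_union, ← Set.preimage_union]
  ext f
  rw [Submodule.restrictScalars_mem, mem_colon_monomialIdeal, mem_restrictSupport_iff]
  refine forall₂_congr fun u _ => ?_
  have hup (v : ℕ × ℕ) (hv : (u 0, u 1) ≤ v) (hu : (u 0, u 1) ∈ upperClosure P) :
    v ∈ upperClosure P := (upperClosure P).upper hv hu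
  have h1 := hup (u 0 + 1, u 1) (by simp)
  have h2 := hup (u 0, u 1 + 1) (by simp)
  simp only [Set.mem_preimage, Set.mem_union, socleSet, Set.mem_ofPred_eq, expVec_symm_apply,
    SetLike.mem_coe]
  tauto

/-- The socle `(I : (x, y)) / I` of `K[x, y] / I`, the module whose length is `socleType I`. -/
noncomputable abbrev socle (I : Ideal (MvPolynomial (Fin 2) K)) :
    Submodule (MvPolynomial (Fin 2) K) (MvPolynomial (Fin 2) K ⧸ I) :=
  Submodule.map I.mkQ (Submodule.colon I (maxIdealXY K : Set (MvPolynomial (Fin 2) K)))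

theorem smul_sub_constantCoeff_smul_mem {I : Ideal (MvPolynomial (Fin 2) K)}
    {g : MvPolynomial (Fin 2) K}
    (hg : g ∈ Submodule.colon I (maxIdealXY K : Set (MvPolynomial (Fin 2) K)))
    (f : MvPolynomial (Fin 2) K) :
    f • g - constantCoeff f • g ∈ I := by
  have hf : f - C (constantCoeff f) ∈ maxIdealXY K := by
    simp [maxIdealXY_eq_ker_constantCoeff, RingHom.mem_ker]
  convert Submodule.mem_colon.1 hg _ hf using 1
  rw [smul_eq_mul, smul_eq_mul, smul_eq_C_mul]
  ring

theorem socleType_eq_length_restrictScalars (I : Ideal (MvPolynomial (Fin 2) K)) :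
    socleType I = Module.length K ((socle I).restrictScalars K) := by
  let _ : Algebra (MvPolynomial (Fin 2) K) K := RingHom.toAlgebra constantCoeff
  have smul_eq (f : MvPolynomial (Fin 2) K) (x : socle I) : f • x = constantCoeff f • x := by
    obtain ⟨_, g, hg, rfl⟩ := x
    ext
    exact (Submodule.Quotient.eq I).2 (smul_sub_constantCoeff_smul_mem hg f)
  have : IsScalarTower (MvPolynomial (Fin 2) K) K (socle I) :=
    ⟨fun f c x => by rw [smul_eq, smul_smul]; rfl⟩
  exact Module.length_eq_of_surjective (R := K) (M := socle I)
    fun c => ⟨C c, constantCoeff_C (Fin 2) c⟩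

theorem socleType_monomialIdeal (P : Set (ℕ × ℕ)) :
    socleType (monomialIdeal K P) = (socleSet (upperClosure P)).encard := by
  let s := expVec.symm ⁻¹' socleSet (upperClosure P)
  let π := (monomialIdeal K P).mkQ.restrictScalars K
  have hker : LinearMap.ker π = (monomialIdeal K P).restrictScalars K := by
    rw [LinearMap.ker_restrictScalars, Submodule.ker_mkQ]
  have hmap : (socle (monomialIdeal K P)).restrictScalars K = (restrictSupport K s).map π := by
    rw [socle, Submodule.restrictScalars_map, restrictScalars_colon_monomialIdeal,
      Submodule.map_sup, ← hker, LinearMap.le_ker_iff_map.1 le_rfl, sup_bot_eq]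
  have hinj : Function.Injective (π.domRestrict (restrictSupport K s)) := by
    rw [LinearMap.injective_domRestrict_iff, hker, restrictScalars_monomialIdeal]
    exact disjoint_restrictSupport (Disjoint.preimage _ (Set.disjoint_left.2 fun p hp => hp.1))
  have hrank : Cardinal.toENat (Module.rank K (restrictSupport K s)) = s.encard := by
    have h := congrArg Cardinal.toENat (basisRestrictSupport K s).mk_eq_rank
    rw [Cardinal.toENat_lift, Cardinal.toENat_lift] at h
    exact h.symm
  rw [socleType_eq_length_restrictScalars, hmap, ← LinearMap.range_domRestrict,
    ← (LinearEquiv.ofInjective _ hinj).length_eq, Module.length_eq_rank, hrank]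
  exact Set.encard_preimage_of_bijective expVec.symm.bijective _

end MonomialIdeals

section Socle

/-- The lower left corner of the rectangle spanned by `p` and `q` lies outside `U`. For points of
`U` this forces `q` to lie strictly to the right of and strictly below `p`, and produces an element
of `socleSet U` between them. -/
def Separated (U : UpperSet (ℕ × ℕ)) (p q : ℕ × ℕ) : Prop :=
  (p.1, q.2) ∉ U

theorem Separated.exists_mem_socleSet {U : UpperSet (ℕ × ℕ)} {p q : ℕ × ℕ}
    (h : Separated U p q) (hp : p ∈ U) (hq : q ∈ U) :
    ∃ s ∈ socleSet U, p.1 ≤ s.1 ∧ s.1 < q.1 := by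
  have hlt {s : ℕ × ℕ} (hs : s ∉ U) (hle : (p.1, q.2) ≤ s) : s.1 < q.1 ∧ s.2 < p.2 :=
    ⟨not_le.1 fun hqs => hs (U.upper ⟨hqs, hle.2⟩ hq),
      not_le.1 fun hps => hs (U.upper (show p ≤ s from ⟨hle.1, hps⟩) hp)⟩
  have hfin : {s | s ∉ U ∧ (p.1, q.2) ≤ s}.Finite :=
    (Set.finite_Iic (q.1, p.2)).subset fun s hs =>
      ⟨(hlt hs.1 hs.2).1.le, (hlt hs.1 hs.2).2.le⟩
  obtain ⟨s, -, ⟨hsU, hle⟩, hmax⟩ := hfin.exists_le_maximal ⟨h, le_rfl⟩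
  have hmem {t : ℕ × ℕ} (hst : s < t) : t ∈ U := by
    by_contra ht
    exact hst.not_ge (hmax ⟨ht, hle.trans hst.le⟩ hst.le)
  exact ⟨s, ⟨hsU, hmem (Prod.mk_lt_mk_iff_left.2 (Nat.lt_succ_self _)),
    hmem (Prod.mk_lt_mk_iff_right.2 (Nat.lt_succ_self _))⟩, hle.1, (hlt hsU hle).1⟩

theorem length_le_encard_socleSet_inter {U : UpperSet (ℕ × ℕ)} {p : ℕ × ℕ} {l : List (ℕ × ℕ)}
    (hU : ∀ q ∈ p :: l, q ∈ U) (hl : (p :: l).IsChain (Separated U)) :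
    (l.length : ℕ∞) ≤ (socleSet U ∩ {s | p.1 ≤ s.1}).encard := by
  induction l generalizing p with
  | nil => simp
  | cons q l ih =>
    rw [List.isChain_cons_cons] at hl
    obtain ⟨s, hs, hps, hsq⟩ := hl.1.exists_mem_socleSet (hU p (by simp)) (hU q (by simp))
    have hnotMem : s ∉ socleSet U ∩ {s | q.1 ≤ s.1} := fun h => hsq.not_ge h.2
    calc ((q :: l).length : ℕ∞) = l.length + 1 := by simp
      _ ≤ (socleSet U ∩ {s | q.1 ≤ s.1}).encard + 1 := by
        gcongr
        exact ih (fun r hr => hU r (List.mem_cons_of_mem p hr)) hl.2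
      _ = (insert s (socleSet U ∩ {s | q.1 ≤ s.1})).encard :=
        (Set.encard_insert_of_notMem hnotMem).symm
      _ ≤ _ := Set.encard_le_encard (Set.insert_subset (Set.mem_inter hs hps)
        (Set.inter_subset_inter_right _ fun _ ht => (hps.trans hsq.le).trans ht))

theorem length_le_encard_socleSet {U : UpperSet (ℕ × ℕ)} {p : ℕ × ℕ} {l : List (ℕ × ℕ)}
    (hU : ∀ q ∈ p :: l, q ∈ U) (hl : (p :: l).IsChain (Separated U)) :
    (l.length : ℕ∞) ≤ (socleSet U).encard :=
  (length_le_encard_socleSet_inter hU hl).trans (Set.encard_le_encard Set.inter_subset_left)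

theorem le_encard_socleSet {U : UpperSet (ℕ × ℕ)} {f : ℕ → ℕ × ℕ} {n : ℕ}
    (hU : ∀ i ≤ n, f i ∈ U) (hf : ∀ i < n, Separated U (f i) (f (i + 1))) :
    (n : ℕ∞) ≤ (socleSet U).encard := by
  have hcons : f 0 :: (List.range n).map (fun i => f (i + 1)) = (List.range (n + 1)).map f := by
    simp [List.range_succ_eq_map]
  have h := length_le_encard_socleSet (U := U) (p := f 0)
    (l := (List.range n).map fun i => f (i + 1)) ?_ ?_
  · simpa using h
  · rw [hcons, List.forall_mem_map]
    exact fun i hi => hU i (Nat.le_of_lt_succ (List.mem_range.1 hi))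
  · rw [hcons, List.isChain_map]
    exact (List.isChain_range_succ _ n).2 hf

theorem socleSet_eq_of_fst_eq {U : UpperSet (ℕ × ℕ)} {s t : ℕ × ℕ} (hs : s ∈ socleSet U)
    (ht : t ∈ socleSet U) (h : s.1 = t.1) : s = t := by
  have hle {s t : ℕ × ℕ} (hs : s ∈ socleSet U) (ht : t ∈ socleSet U) (h : s.1 = t.1) :
      t.2 ≤ s.2 :=
    not_lt.1 fun hlt => ht.1 (U.upper (Prod.mk_le_mk.2 ⟨h.le, hlt⟩) hs.2.2)
  exact Prod.ext h (le_antisymm (hle ht hs h.symm) (hle hs ht h))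

theorem exists_fst_eq_of_mem_socleSet {P : Set (ℕ × ℕ)} {s : ℕ × ℕ}
    (hs : s ∈ socleSet (upperClosure P)) : ∃ g ∈ P, g.1 = s.1 + 1 := by
  obtain ⟨hs0, hs1, -⟩ := hs
  obtain ⟨g, hg, hle⟩ := mem_upperClosure.1 hs1
  refine ⟨g, hg, hle.1.antisymm (not_le.1 fun h => hs0 (mem_upperClosure.2 ⟨g, hg, h, hle.2⟩))⟩

theorem encard_socleSet_add_one_le {G : Finset (ℕ × ℕ)} (hG : G.Nonempty) :
    (socleSet (upperClosure (G : Set (ℕ × ℕ)))).encard + 1 ≤ G.card := by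
  obtain ⟨h, hh, hmin⟩ := G.exists_min_image Prod.fst hG
  have hex (s) (hs : s ∈ socleSet (upperClosure (G : Set (ℕ × ℕ)))) :
      ∃ g ∈ G.erase h, g.1 = s.1 + 1 := by
    obtain ⟨g, hg, hgs⟩ := exists_fst_eq_of_mem_socleSet hs
    obtain ⟨g', hg', hle⟩ := mem_upperClosure.1 hs.2.2
    refine ⟨g, Finset.mem_erase.2 ⟨?_, hg⟩, hgs⟩
    rintro rfl
    exact absurd ((hmin g' hg').trans hle.1) (by simp [hgs])
  choose! g hg hgs using hex
  have hinj : Set.InjOn g (socleSet (upperClosure (G : Set (ℕ × ℕ)))) := fun s hs t ht hst =>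
    socleSet_eq_of_fst_eq hs ht (by have := hgs s hs; rw [hst, hgs t ht] at this; omega)
  calc _ ≤ ((G.erase h : Finset (ℕ × ℕ)) : Set (ℕ × ℕ)).encard + 1 := by
        exact add_le_add_left (Set.encard_le_encard_of_injOn hg hinj) 1
    _ = G.card := by
      rw [Set.encard_coe_eq_coe_finsetCard, ← Finset.card_erase_add_one hh]
      norm_cast

theorem socleSet_map_prodComm (U : UpperSet (ℕ × ℕ)) :
    socleSet (UpperSet.map OrderIso.prodComm U) = Prod.swap '' socleSet U := by
  ext s
  simp [socleSet, Set.image_swap_eq_preimage_swap, UpperSet.mem_map, and_comm]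

end Socle

section Staircase

/-- A finite sequence of points descending from the upper left to the lower right. -/
structure IsStaircase {α β : Type*} [Preorder α] [Preorder β] {m : ℕ} (p : Fin m → α × β) :
    Prop where
  strictMono_fst : StrictMono fun i => (p i).1
  strictAnti_snd : StrictAnti fun i => (p i).2

/-- The mirror image of a sequence of points in the diagonal, traversed backwards, so that
staircases go to staircases. -/
def reflect {α β : Type*} {m : ℕ} (p : Fin m → α × β) : Fin m → β × α :=
  fun i => (p i.rev).swap

theorem IsStaircase.reflect {α β : Type*} [Preorder α] [Preorder β] {m : ℕ} {p : Fin m → α × β}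
    (hp : IsStaircase p) : IsStaircase (reflect p) :=
  ⟨fun _ _ h => hp.strictAnti_snd (Fin.rev_lt_rev.2 h),
    fun _ _ h => hp.strictMono_fst (Fin.rev_lt_rev.2 h)⟩

theorem range_reflect {α β : Type*} {m : ℕ} (p : Fin m → α × β) :
    Set.range (reflect p) = Prod.swap '' Set.range p := by
  rw [← Set.range_comp]
  exact Fin.rev_surjective.range_comp (Prod.swap ∘ p)

theorem exists_isStaircase_range_eq {α β : Type*} [LinearOrder α] [LinearOrder β]
    {G : Finset (α × β)} (hG : IsAntichain (· ≤ ·) (G : Set (α × β))) {m : ℕ} (hm : G.card = m) :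
    ∃ p : Fin m → α × β, IsStaircase p ∧ Set.range p = G := by
  let e := (G.map toLex.toEmbedding).orderEmbOfFin ((Finset.card_map _).trans hm)
  have hrange : Set.range (fun i => ofLex (e i)) = G := by
    rw [Set.range_comp', Finset.range_orderEmbOfFin, Finset.coe_map, Set.image_image]
    simp
  have hmem (i) : ofLex (e i) ∈ (G : Set (α × β)) := hrange ▸ Set.mem_range_self i
  have hanti : StrictAnti fun i => (ofLex (e i)).2 := fun i j hij => by
    by_contra! hle
    have hlt := e.strictMono hij
    refine hlt.ne (ofLex.injective (hG.eq (hmem i) (hmem j) ⟨?_, hle⟩))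
    exact (Prod.Lex.le_iff'.1 hlt.le).1
  refine ⟨fun i => ofLex (e i), ⟨fun i j hij => ?_, hanti⟩, hrange⟩
  exact (Prod.Lex.lt_iff.1 (e.strictMono hij)).resolve_right fun h => (hanti hij).not_gt h.2

theorem exists_finset_antichain_upperClosure_eq (P : Set (ℕ × ℕ)) :
    ∃ G : Finset (ℕ × ℕ), IsAntichain (· ≤ ·) (G : Set (ℕ × ℕ)) ∧
      upperClosure (G : Set (ℕ × ℕ)) = upperClosure P := by
  have hanti : IsAntichain (· ≤ ·) {p | Minimal (· ∈ P) p} := setOfPred_minimal_antichain _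
  have hfin : {p | Minimal (· ∈ P) p}.Finite :=
    hanti.finite_of_partiallyWellOrderedOn (Set.isPWO_of_wellQuasiOrderedLE _)
  refine ⟨hfin.toFinset, by simpa using hanti, ?_⟩
  rw [Set.Finite.coe_toFinset]
  refine le_antisymm (fun q hq => ?_) (upperClosure_anti fun q hq => hq.prop)
  obtain ⟨p, hp, hpq⟩ := mem_upperClosure.1 hq
  obtain ⟨p', hp', hmin⟩ := exists_minimal_le_of_wellFoundedLT (· ∈ P) p hp
  exact mem_upperClosure.2 ⟨p', hmin, hp'.trans hpq⟩

theorem exists_isStaircase_upperClosure_eq {P : Set (ℕ × ℕ)} {n : ℕ} (hn : n ≠ 0)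
    (h : (n : ℕ∞) ≤ (socleSet (upperClosure P)).encard) :
    ∃ (m : ℕ) (p : Fin (m + (n + 1)) → ℕ × ℕ), IsStaircase p ∧
      upperClosure (Set.range p) = upperClosure P := by
  obtain ⟨G, hanti, hG⟩ := exists_finset_antichain_upperClosure_eq P
  have hne : G.Nonempty := by
    rw [Finset.nonempty_iff_ne_empty]
    rintro rfl
    have hempty : socleSet (upperClosure P) = ∅ := by
      rw [← hG]
      ext
      simp [socleSet]
    simp [hempty, hn] at h
  have hcard : n + 1 ≤ G.card := by
    have := (add_le_add_left h 1).trans (hG ▸ encard_socleSet_add_one_le hne)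
    exact_mod_cast this
  obtain ⟨m, hm⟩ := Nat.exists_eq_add_of_le' hcard
  obtain ⟨p, hp, hrange⟩ := exists_isStaircase_range_eq hanti hm
  exact ⟨m, p, hp, by rw [hrange, hG]⟩

end Staircase

section Square

variable {m : ℕ} {p : Fin (m + 6) → ℕ × ℕ}

/-- The exponents of the monomials in the square of the ideal generated by the monomials with
exponents `p i`. -/
def squareExponents {ι : Type*} (p : ι → ℕ × ℕ) : UpperSet (ℕ × ℕ) :=
  upperClosure (Set.range p + Set.range p)

theorem mem_squareExponents {ι : Type*} {p : ι → ℕ × ℕ} {q : ℕ × ℕ} :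
    q ∈ squareExponents p ↔ ∃ i j, p i + p j ≤ q := by
  simp [squareExponents, mem_upperClosure, Set.mem_add]

theorem add_mem_squareExponents {ι : Type*} (p : ι → ℕ × ℕ) (i j : ι) :
    p i + p j ∈ squareExponents p :=
  mem_squareExponents.2 ⟨i, j, le_rfl⟩

theorem squareExponents_reflect {n : ℕ} (p : Fin n → ℕ × ℕ) :
    squareExponents (reflect p) = UpperSet.map OrderIso.prodComm (squareExponents p) := by
  rw [squareExponents, squareExponents, ← upperClosure_image, range_reflect]
  exact congrArg upperClosure (Set.image_add (AddEquiv.prodComm (M := ℕ) (N := ℕ))).symm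

theorem encard_socleSet_squareExponents_reflect {n : ℕ} (p : Fin n → ℕ × ℕ) :
    (socleSet (squareExponents (reflect p))).encard = (socleSet (squareExponents p)).encard := by
  rw [squareExponents_reflect, socleSet_map_prodComm, Prod.swap_injective.encard_image]

theorem separated_map_prodComm {U : UpperSet (ℕ × ℕ)} {p q : ℕ × ℕ} :
    Separated (UpperSet.map OrderIso.prodComm U) p.swap q.swap ↔ Separated U q p := by
  simp [Separated, UpperSet.mem_map]

theorem IsStaircase.eq_or_between (hp : IsStaircase p) (j : Fin (m + 6)) :
    (j = 0 ∨ j = 1 ∨ j = 2 ∨ j = Fin.rev 2 ∨ j = Fin.rev 1 ∨ j = Fin.rev 0) ∨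
      ((p 2).1 < (p j).1 ∧ (p j).1 < (p (Fin.rev 2)).1) ∧
        ((p (Fin.rev 2)).2 < (p j).2 ∧ (p j).2 < (p 2).2) := by
  rw [hp.strictMono_fst.lt_iff_lt, hp.strictMono_fst.lt_iff_lt, hp.strictAnti_snd.lt_iff_gt,
    hp.strictAnti_snd.lt_iff_gt]
  simp only [Fin.ext_iff, Fin.lt_def, Fin.val_rev, Fin.val_zero, Fin.val_one, Fin.val_two]
  omega

theorem IsStaircase.fst_lt_fst (hp : IsStaircase p) :
    (p 0).1 < (p 1).1 ∧ (p 1).1 < (p 2).1 ∧ (p 2).1 < (p (Fin.rev 2)).1 ∧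
      (p (Fin.rev 2)).1 < (p (Fin.rev 1)).1 ∧ (p (Fin.rev 1)).1 < (p (Fin.rev 0)).1 := by
  simp only [hp.strictMono_fst.lt_iff_lt, Fin.lt_def, Fin.val_rev, Fin.val_zero, Fin.val_one,
    Fin.val_two]
  omega

theorem IsStaircase.snd_lt_snd (hp : IsStaircase p) :
    (p (Fin.rev 0)).2 < (p (Fin.rev 1)).2 ∧ (p (Fin.rev 1)).2 < (p (Fin.rev 2)).2 ∧
      (p (Fin.rev 2)).2 < (p 2).2 ∧ (p 2).2 < (p 1).2 ∧ (p 1).2 < (p 0).2 := by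
  simpa [_root_.reflect] using hp.reflect.fst_lt_fst

theorem separated_of_fst_le (hp : IsStaircase p) {a b : ℕ × ℕ}
    (h : a.1 ≤ (p 1).1 + (p 2).1 ∧
      ¬ p 0 + p 0 ≤ (a.1, b.2) ∧
      ¬ p 0 + p 1 ≤ (a.1, b.2) ∧
      ¬ p 0 + p 2 ≤ (a.1, b.2) ∧
      (a.1 ≤ (p 0).1 + (p 2).1 ∨ b.2 ≤ (p 0).2 + (p (Fin.rev 2)).2) ∧
      ¬ p 0 + p (Fin.rev 2) ≤ (a.1, b.2) ∧
      ¬ p 0 + p (Fin.rev 1) ≤ (a.1, b.2) ∧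
      ¬ p 0 + p (Fin.rev 0) ≤ (a.1, b.2) ∧
      ¬ p 1 + p 1 ≤ (a.1, b.2) ∧
      ¬ p 1 + p 2 ≤ (a.1, b.2)) :
    Separated (squareExponents p) a b := by
  intro hmem
  obtain ⟨s, t, h1, h2⟩ := mem_squareExponents.1 hmem
  wlog hst : s ≤ t generalizing s t
  · exact this t s (add_comm (p s) (p t) ▸ h1) (add_comm (p s) (p t) ▸ h2) (le_of_not_ge hst)
  simp only [Prod.le_def, Prod.fst_add, Prod.snd_add] at h h1 h2
  have hfst := hp.fst_lt_fst
  obtain rfl | rfl | hs : s = 0 ∨ s = 1 ∨ 2 ≤ s := by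
    simp only [Fin.ext_iff, Fin.le_def, Fin.val_zero, Fin.val_one, Fin.val_two]
    omega
  -- `p 0 + p t` with `2 < t < Fin.rev 2` is excluded by the disjunction among the hypotheses.
  · obtain (rfl | rfl | rfl | rfl | rfl | rfl) | ht := hp.eq_or_between t <;> omega
  · obtain rfl | rfl | ht : t = 1 ∨ t = 2 ∨ 2 < t := by
      simp only [Fin.ext_iff, Fin.le_def, Fin.lt_def, Fin.val_one, Fin.val_two] at hst ⊢
      omega
    · omega
    · omega
    · have : (p 2).1 < (p t).1 := hp.strictMono_fst ht
      omega
  · have : (p 2).1 ≤ (p s).1 := hp.strictMono_fst.monotone hs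
    have : (p 2).1 ≤ (p t).1 := hp.strictMono_fst.monotone (hs.trans hst)
    omega

theorem separated_of_snd_le (hp : IsStaircase p) {a b : ℕ × ℕ}
    (h : b.2 ≤ (p (Fin.rev 1)).2 + (p (Fin.rev 2)).2 ∧
      ¬ p (Fin.rev 0) + p 0 ≤ (a.1, b.2) ∧
      ¬ p (Fin.rev 0) + p 1 ≤ (a.1, b.2) ∧
      ¬ p (Fin.rev 0) + p 2 ≤ (a.1, b.2) ∧
      (a.1 ≤ (p (Fin.rev 0)).1 + (p 2).1 ∨ b.2 ≤ (p (Fin.rev 0)).2 + (p (Fin.rev 2)).2) ∧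
      ¬ p (Fin.rev 0) + p (Fin.rev 2) ≤ (a.1, b.2) ∧
      ¬ p (Fin.rev 0) + p (Fin.rev 1) ≤ (a.1, b.2) ∧
      ¬ p (Fin.rev 0) + p (Fin.rev 0) ≤ (a.1, b.2) ∧
      ¬ p (Fin.rev 1) + p (Fin.rev 1) ≤ (a.1, b.2) ∧
      ¬ p (Fin.rev 1) + p (Fin.rev 2) ≤ (a.1, b.2)) :
    Separated (squareExponents p) a b := by
  rw [← separated_map_prodComm, ← squareExponents_reflect]
  refine separated_of_fst_le hp.reflect ?_
  simp only [reflect, Fin.rev_rev, Prod.le_def, Prod.fst_add, Prod.snd_add, Prod.fst_swap,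
    Prod.snd_swap] at h ⊢
  omega

/-- A sum of two points which comes third in the square of the staircase `p`, after `p 0 + p 0` and
`p 0 + p 1`. -/
def leftPoint (p : Fin (m + 6) → ℕ × ℕ) : ℕ × ℕ :=
  if 2 * (p 1).1 ≤ (p 0).1 + (p 2).1 then p 1 + p 1 else p 0 + p 2

/-- The mirror image of `leftPoint`. -/
def rightPoint (p : Fin (m + 6) → ℕ × ℕ) : ℕ × ℕ :=
  if 2 * (p (Fin.rev 1)).2 ≤ (p (Fin.rev 0)).2 + (p (Fin.rev 2)).2 then
    p (Fin.rev 1) + p (Fin.rev 1) else p (Fin.rev 2) + p (Fin.rev 0)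

theorem leftPoint_mem (p : Fin (m + 6) → ℕ × ℕ) : leftPoint p ∈ squareExponents p := by
  rw [leftPoint]
  split_ifs <;> exact add_mem_squareExponents p _ _

theorem rightPoint_mem (p : Fin (m + 6) → ℕ × ℕ) : rightPoint p ∈ squareExponents p := by
  rw [rightPoint]
  split_ifs <;> exact add_mem_squareExponents p _ _

theorem fst_leftPoint (p : Fin (m + 6) → ℕ × ℕ) :
    (leftPoint p).1 = min (2 * (p 1).1) ((p 0).1 + (p 2).1) := by
  rw [leftPoint]
  split_ifs <;> simp only [Prod.fst_add] <;> omega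

theorem snd_leftPoint_lt (hp : IsStaircase p) : (leftPoint p).2 < (p 0).2 + (p 1).2 := by
  have hsnd := hp.snd_lt_snd
  rw [leftPoint]
  split_ifs <;> simp only [Prod.snd_add] <;> omega

theorem fst_rightPoint_lt (hp : IsStaircase p) :
    (rightPoint p).1 < (p (Fin.rev 1)).1 + (p (Fin.rev 0)).1 := by
  have hfst := hp.fst_lt_fst
  rw [rightPoint]
  split_ifs <;> simp only [Prod.fst_add] <;> omega

theorem snd_rightPoint (p : Fin (m + 6) → ℕ × ℕ) :
    (rightPoint p).2 = min (2 * (p (Fin.rev 1)).2) ((p (Fin.rev 0)).2 + (p (Fin.rev 2)).2) := by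
  rw [rightPoint]
  split_ifs <;> simp only [Prod.snd_add] <;> omega

theorem eight_le_of_separated (hp : IsStaircase p) {a b c : ℕ × ℕ} (ha : a ∈ squareExponents p)
    (hb : b ∈ squareExponents p) (hc : c ∈ squareExponents p)
    (hla : Separated (squareExponents p) (leftPoint p) a)
    (hab : Separated (squareExponents p) a b) (hbc : Separated (squareExponents p) b c)
    (hcr : Separated (squareExponents p) c (rightPoint p)) :
    8 ≤ (socleSet (squareExponents p)).encard := by
  have hfst := hp.fst_lt_fst
  have hsnd := hp.snd_lt_snd
  have hleft := snd_leftPoint_lt hp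
  have hright := fst_rightPoint_lt hp
  refine length_le_encard_socleSet (p := p 0 + p 0) (l := [p 0 + p 1, leftPoint p, a, b, c,
    rightPoint p, p (Fin.rev 1) + p (Fin.rev 0), p (Fin.rev 0) + p (Fin.rev 0)]) ?_ ?_
  · simp [add_mem_squareExponents, leftPoint_mem, rightPoint_mem, ha, hb, hc]
  · simp only [List.isChain_cons_cons, List.isChain_singleton, and_true]
    refine ⟨separated_of_fst_le hp ?_, separated_of_fst_le hp ?_, hla, hab, hbc, hcr,
      separated_of_snd_le hp ?_, separated_of_snd_le hp ?_⟩ <;>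
    simp only [Prod.le_def, Prod.fst_add, Prod.snd_add] <;>
    omega

theorem eight_le_of_corner_sum_le (hp : IsStaircase p)
    (hx : (p 0).1 + (p (Fin.rev 0)).1 ≤ (p 1).1 + (p 2).1)
    (hy : (p 0).2 + (p (Fin.rev 0)).2 ≤ (p 1).2 + (p (Fin.rev 1)).2) :
    8 ≤ (socleSet (squareExponents p)).encard := by
  have hfst := hp.fst_lt_fst
  have hsnd := hp.snd_lt_snd
  have hmem := add_mem_squareExponents p
  rcases le_or_gt (2 * (p 1).2) ((p 0).2 + (p (Fin.rev 1)).2) with hy1 | hy1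
  · refine eight_le_of_separated hp (hmem 0 (Fin.rev 0)) (hmem 1 (Fin.rev 0))
      (hmem 2 (Fin.rev 0)) (separated_of_fst_le hp ?_) (separated_of_fst_le hp ?_)
      (separated_of_snd_le hp ?_) (separated_of_snd_le hp ?_) <;>
    simp only [fst_leftPoint, snd_rightPoint, Prod.le_def, Prod.fst_add, Prod.snd_add] <;>
    omega
  rcases le_or_gt (2 * (p 1).1) ((p 0).1 + (p 2).1) with hx1 | hx1
  · refine eight_le_of_separated hp (hmem 0 (Fin.rev 1)) (hmem 0 (Fin.rev 0))
      (hmem 1 (Fin.rev 0)) (separated_of_fst_le hp ?_) (separated_of_fst_le hp ?_)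
      (separated_of_fst_le hp ?_) (separated_of_snd_le hp ?_) <;>
    simp only [fst_leftPoint, snd_rightPoint, Prod.le_def, Prod.fst_add, Prod.snd_add] <;>
    omega
  · refine eight_le_of_separated hp (hmem 0 (Fin.rev 2)) (hmem 0 (Fin.rev 1))
      (hmem 0 (Fin.rev 0)) (separated_of_fst_le hp ?_) (separated_of_fst_le hp ?_)
      (separated_of_fst_le hp ?_) (separated_of_fst_le hp ?_) <;>
    simp only [fst_leftPoint, snd_rightPoint, Prod.le_def, Prod.fst_add, Prod.snd_add] <;>
    omega

theorem eight_le_of_lt_corner_sum (hp : IsStaircase p)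
    (hl : (p 1).1 + (p 2).1 < (p 0).1 + (p (Fin.rev 0)).1 ∨
      (p 1).2 + (p (Fin.rev 1)).2 < (p 0).2 + (p (Fin.rev 0)).2)
    (hr : (p (Fin.rev 1)).2 + (p (Fin.rev 2)).2 < (p 0).2 + (p (Fin.rev 0)).2 ∨
      (p 1).1 + (p (Fin.rev 1)).1 < (p 0).1 + (p (Fin.rev 0)).1) :
    8 ≤ (socleSet (squareExponents p)).encard := by
  have hfst := hp.fst_lt_fst
  have hsnd := hp.snd_lt_snd
  have hmem := add_mem_squareExponents p
  refine eight_le_of_separated hp (hmem 1 2) (hmem 1 (Fin.rev 1)) (hmem (Fin.rev 2) (Fin.rev 1))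
    (separated_of_fst_le hp ?_) (separated_of_fst_le hp ?_) (separated_of_snd_le hp ?_)
    (separated_of_snd_le hp ?_) <;>
  simp only [fst_leftPoint, snd_rightPoint, Prod.le_def, Prod.fst_add, Prod.snd_add] <;>
  omega

theorem eight_le_encard_socleSet_squareExponents (hp : IsStaircase p) :
    8 ≤ (socleSet (squareExponents p)).encard := by
  by_cases hl : (p 0).1 + (p (Fin.rev 0)).1 ≤ (p 1).1 + (p 2).1 ∧
      (p 0).2 + (p (Fin.rev 0)).2 ≤ (p 1).2 + (p (Fin.rev 1)).2
  · exact eight_le_of_corner_sum_le hp hl.1 hl.2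
  by_cases hr : (p 0).2 + (p (Fin.rev 0)).2 ≤ (p (Fin.rev 1)).2 + (p (Fin.rev 2)).2 ∧
      (p 0).1 + (p (Fin.rev 0)).1 ≤ (p 1).1 + (p (Fin.rev 1)).1
  · rw [← encard_socleSet_squareExponents_reflect]
    refine eight_le_of_corner_sum_le hp.reflect ?_ ?_ <;>
    · simp only [reflect, Fin.rev_rev, Prod.fst_swap, Prod.snd_swap]
      omega
  · exact eight_le_of_lt_corner_sum hp (by omega) (by omega)

theorem eight_le_socleType_sq {K : Type*} [Field K] {I : Ideal (MvPolynomial (Fin 2) K)}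
    (hI : IsMonomialIdeal I) (h : 5 ≤ socleType I) : 8 ≤ socleType (I ^ 2) := by
  obtain ⟨P, rfl⟩ := hI.exists_eq_monomialIdeal
  rw [socleType_monomialIdeal] at h
  obtain ⟨m, p, hp, hP⟩ := exists_isStaircase_upperClosure_eq (n := 5) (by norm_num) h
  rw [monomialIdeal_congr hP.symm, monomialIdeal_pow, two_nsmul, socleType_monomialIdeal]
  exact eight_le_encard_socleSet_squareExponents hp

end Square

section Descending

open Finset.HasAntidiagonal (antidiagonal mem_antidiagonal)

theorem mem_succ_nsmul_or {α : Type*} [AddCommMonoid α] {P : Set α} (Q : Set α) {k : ℕ} {q : α}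
    (hq : q ∈ (k + 1) • P) :
    q ∈ (k + 1) • Q ∨ ∃ q' ∈ k • P, ∃ p ∈ P \ Q, q' + p = q := by
  induction k generalizing q with
  | zero =>
    simp only [zero_add, one_nsmul, zero_nsmul, Set.mem_zero, exists_eq_left, exists_eq_right] at *
    exact or_iff_not_imp_left.2 fun h => ⟨hq, h⟩
  | succ k ih =>
    rw [succ_nsmul] at hq
    obtain ⟨q, hq, p, hp, rfl⟩ := hq
    rcases ih hq with h | ⟨r, hr, s, hs, rfl⟩
    · by_cases hpQ : p ∈ Q
      · exact Or.inl (succ_nsmul Q (k + 1) ▸ Set.add_mem_add h hpQ)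
      · exact Or.inr ⟨q, hq, p, ⟨hp, hpQ⟩, rfl⟩
    · exact Or.inr ⟨r + p, succ_nsmul P k ▸ Set.add_mem_add hr hp, s, hs, add_right_comm r p s⟩

theorem le_of_mul_add_le {m a b s t : ℕ} (h : m * a + s ≤ m * b + t) (ht : t < m) : a ≤ b := by
  refine Nat.lt_succ_iff.1 (Nat.lt_of_mul_lt_mul_left (a := m) ?_)
  rw [Nat.succ_eq_add_one, mul_add]
  omega

theorem le_of_nsmul_add_le {m : ℕ} {c c' d d' : ℕ × ℕ} (h : m • c + d ≤ m • c' + d')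
    (h1 : d'.1 < m) (h2 : d'.2 < m) : c ≤ c' :=
  ⟨le_of_mul_add_le h.1 h1, le_of_mul_add_le h.2 h2⟩

theorem encard_socleSet_nsmul_antidiagonal {m : ℕ} (hm : 0 < m) (n : ℕ) :
    (socleSet (upperClosure ((m • ·) '' (antidiagonal n : Set (ℕ × ℕ))))).encard = n := by
  refine le_antisymm ?_ (le_encard_socleSet (f := fun i => m • (i, n - i)) ?_ ?_)
  · have hne : (antidiagonal n).Nonempty := ⟨(0, n), by simp⟩
    have h : (socleSet _).encard + 1 ≤ _ := encard_socleSet_add_one_le (hne.image (m • ·))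
    have hcard := (Finset.card_image_le (s := antidiagonal n) (f := (m • ·))).trans_eq
      (Finset.Nat.card_antidiagonal n)
    rw [Finset.coe_image] at h
    exact (ENat.add_le_add_iff_right ENat.one_ne_top).1 (h.trans (by exact_mod_cast hcard))
  · intro i hi
    exact subset_upperClosure ⟨(i, n - i), by simpa using Nat.add_sub_of_le hi, rfl⟩
  · intro i hi h
    obtain ⟨_, ⟨c, hc, rfl⟩, hle⟩ := mem_upperClosure.1 h
    have hc : c.1 + c.2 = n := by simpa using hc
    have h1 : c ≤ (i, n - (i + 1)) := le_of_nsmul_add_le (d := 0) (d' := 0) hle hm hm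
    have h2 := Prod.le_def.1 h1
    simp only at h2
    omega

section OuterCells

/-- The abscissae and ordinates of the four outer cells: on the antidiagonal `c.1 + c.2 = n + 2` of
an array of cells, they are the two outermost ones at either end. -/
def outerCells (n : ℕ) : Finset (ℕ × ℕ) :=
  {(0, n + 2), (1, n + 1), (n + 1, 1), (n + 2, 0)}

variable {n k : ℕ} {c : ℕ × ℕ}

theorem nsmul_add_nsmul_add_nsmul_mem {α : Type*} [AddMonoid α] {P : Set α} {p q r : α}
    (hp : p ∈ P) (hq : q ∈ P) (hr : r ∈ P) (a b c : ℕ) :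
    a • p + b • q + c • r ∈ (a + b + c) • P := by
  rw [add_nsmul, add_nsmul]
  exact Set.add_mem_add (Set.add_mem_add (Set.nsmul_mem_nsmul hp) (Set.nsmul_mem_nsmul hq))
    (Set.nsmul_mem_nsmul hr)

theorem mem_nsmul_outerCells {a b : ℕ} (ha : a ≤ k) (hb : b ≤ k) (hc1 : c.1 = a * (n + 1) + b)
    (hc : c.1 + c.2 = k * (n + 2)) : c ∈ k • (outerCells n : Set (ℕ × ℕ)) := by
  have h0 : (0, n + 2) ∈ (outerCells n : Set (ℕ × ℕ)) := by simp [outerCells]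
  have h1 : (1, n + 1) ∈ (outerCells n : Set (ℕ × ℕ)) := by simp [outerCells]
  have h2 : (n + 1, 1) ∈ (outerCells n : Set (ℕ × ℕ)) := by simp [outerCells]
  have h3 : (n + 2, 0) ∈ (outerCells n : Set (ℕ × ℕ)) := by simp [outerCells]
  rcases le_total b a with hba | hab
  · obtain ⟨u, rfl⟩ := Nat.exists_eq_add_of_le hba
    obtain ⟨v, rfl⟩ := Nat.exists_eq_add_of_le ha
    convert nsmul_add_nsmul_add_nsmul_mem h3 h2 h0 b u v using 1
    ext <;>
    simp only [Prod.smul_mk, smul_eq_mul, mul_one, Prod.mk_add_mk] <;>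
    nlinarith
  · obtain ⟨u, rfl⟩ := Nat.exists_eq_add_of_le hab
    obtain ⟨v, rfl⟩ := Nat.exists_eq_add_of_le hb
    convert nsmul_add_nsmul_add_nsmul_mem h3 h1 h0 a u v using 1
    ext <;>
    simp only [Prod.smul_mk, smul_eq_mul, mul_one, Prod.mk_add_mk] <;>
    nlinarith

theorem mem_nsmul_outerCells_or (hc : c.1 + c.2 = k * (n + 2)) :
    c ∈ k • (outerCells n : Set (ℕ × ℕ)) ∨ ∃ j c', j + k < n ∧
      c' ∈ (k - 1) • (outerCells n : Set (ℕ × ℕ)) ∧ c = c' + (n - j, j + 2) := by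
  rcases Nat.lt_or_ge c.1 (k * (n + 1)) with h | h
  · obtain ⟨a, b, ha, hbn, hc1⟩ : ∃ a b, a < k ∧ b ≤ n ∧ c.1 = a * (n + 1) + b :=
      ⟨c.1 / (n + 1), c.1 % (n + 1), Nat.div_lt_of_lt_mul (by rwa [mul_comm]),
        Nat.le_of_lt_succ (Nat.mod_lt _ n.succ_pos), (Nat.div_add_mod' _ _).symm⟩
    rcases le_or_gt b k with hbk | hbk
    · exact Or.inl (mem_nsmul_outerCells ha.le hbk hc1 hc)
    obtain ⟨k, rfl⟩ := Nat.exists_eq_add_of_lt ha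
    obtain ⟨j, rfl⟩ := Nat.exists_eq_add_of_le hbn
    refine Or.inr ⟨j, (a * (b + j + 1), a + k * (b + j + 2)), by omega,
      mem_nsmul_outerCells (a := a) (b := 0) (by omega) (by omega) rfl ?_, Prod.ext ?_ ?_⟩
    · rw [Nat.add_sub_cancel]
      ring
    · simp only [Prod.fst_add]
      omega
    · simp only [Prod.snd_add]
      nlinarith
  · obtain ⟨b, hb⟩ := Nat.exists_eq_add_of_le h
    exact Or.inl (mem_nsmul_outerCells le_rfl (by nlinarith) hb hc)

theorem fst_add_snd_of_mem_outerCells (hc : c ∈ outerCells n) :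
    c.1 + c.2 = n + 2 ∧ (c.1 ≤ 1 ∨ n + 1 ≤ c.1) := by
  simp only [outerCells, Finset.mem_insert, Finset.mem_singleton] at hc
  rcases hc with rfl | rfl | rfl | rfl <;> dsimp only <;> omega

theorem fst_add_snd_of_mem_nsmul_outerCells (hc : c ∈ k • (outerCells n : Set (ℕ × ℕ))) :
    c.1 + c.2 = k * (n + 2) := by
  induction k generalizing c with
  | zero =>
    rw [zero_nsmul, Set.mem_zero] at hc
    simp [hc]
  | succ k ih =>
    rw [succ_nsmul] at hc
    obtain ⟨c, hc, d, hd, rfl⟩ := hc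
    have h1 := ih hc
    have h2 := (fst_add_snd_of_mem_outerCells hd).1
    rw [add_mul]
    simp only [Prod.fst_add, Prod.snd_add]
    omega

theorem nsmul_outerCells_self (n : ℕ) :
    n • (outerCells n : Set (ℕ × ℕ)) = antidiagonal (n * (n + 2)) := by
  ext c
  rw [Finset.mem_coe, mem_antidiagonal]
  refine ⟨fst_add_snd_of_mem_nsmul_outerCells, fun hc => ?_⟩
  exact (mem_nsmul_outerCells_or hc).resolve_right fun ⟨_, _, hj, _⟩ =>
    (Nat.le_add_left _ _).not_gt hj

end OuterCells

section CellGens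

/-- The rapidly growing sequence which controls the generators: there are `cornerScale n j ^ n + 1`
of them in the `j`-th inner cell, and `cornerScale n j` of them in the outer cells and the inner
cells before the `j`-th one together. -/
def cornerScale (n : ℕ) : ℕ → ℕ
  | 0 => 4
  | j + 1 => cornerScale n j + (cornerScale n j ^ n + 1)

/-- The side length of the cells in which the generators are placed. -/
def cellSize (n : ℕ) : ℕ := cornerScale n n

/-- The generators inside the `j`-th inner cell, whose lower left corner is
`cellSize n • (n - j, j + 2)`. -/
def innerGens (n j : ℕ) : Finset (ℕ × ℕ) :=
  (antidiagonal (cornerScale n j ^ n)).image fun e =>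
    cellSize n • (n - j, j + 2) + ((cornerScale n j, cornerScale n j) + e)

/-- The lower left corners of the outer cells, together with the generators inside the first
`n - k` inner cells. The ideal with descending types belongs to `cellGens n 1`; its `k`-th power is
generated in the same way as that of `cellGens n k`. -/
def cellGens (n k : ℕ) : Finset (ℕ × ℕ) :=
  (outerCells n).image (cellSize n • ·) ∪ (Finset.range (n - k)).biUnion (innerGens n)

variable {n k : ℕ}

theorem cornerScale_succ (n j : ℕ) :
    cornerScale n (j + 1) = cornerScale n j + (cornerScale n j ^ n + 1) := rfl

theorem cornerScale_monotone (n : ℕ) : Monotone (cornerScale n) :=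
  monotone_nat_of_le_succ fun j => by rw [cornerScale_succ]; omega

theorem cornerScale_pos (n j : ℕ) : 0 < cornerScale n j :=
  zero_lt_four.trans_le (cornerScale_monotone n j.zero_le)

theorem cornerScale_add_pow_lt {i j : ℕ} (h : j < i) :
    cornerScale n j + cornerScale n j ^ n < cornerScale n i :=
  Nat.lt_of_succ_le (cornerScale_monotone n h)

theorem four_add_sum_cornerScale (n j : ℕ) :
    4 + ∑ i ∈ Finset.range j, (cornerScale n i ^ n + 1) = cornerScale n j := by
  induction j with
  | zero => rfl
  | succ j ih => rw [Finset.sum_range_succ, ← add_assoc, ih, cornerScale_succ]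

theorem mem_innerGens {j : ℕ} {p : ℕ × ℕ} : p ∈ innerGens n j ↔
    ∃ e : ℕ × ℕ, e.1 + e.2 = cornerScale n j ^ n ∧
      cellSize n • (n - j, j + 2) + ((cornerScale n j, cornerScale n j) + e) = p := by
  simp only [innerGens, Finset.mem_image, mem_antidiagonal]

theorem mem_cellGens {p : ℕ × ℕ} : p ∈ cellGens n k ↔
    (∃ c ∈ outerCells n, cellSize n • c = p) ∨ ∃ j, j + k < n ∧ p ∈ innerGens n j := by
  simp only [cellGens, Finset.mem_union, Finset.mem_image, Finset.mem_biUnion, Finset.mem_range,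
    Nat.lt_sub_iff_add_lt]

theorem cellGens_antitone (n : ℕ) : Antitone (cellGens n) := fun k l hkl p hp => by
  rw [mem_cellGens] at hp ⊢
  exact hp.imp_right fun ⟨j, hj, h⟩ => ⟨j, by omega, h⟩

theorem nsmul_mem_cellGens {c : ℕ × ℕ} (hc : c ∈ outerCells n) : cellSize n • c ∈ cellGens n k :=
  mem_cellGens.2 (Or.inl ⟨c, hc, rfl⟩)

theorem card_cellGens_le (n k : ℕ) : (cellGens n k).card ≤ cornerScale n (n - k) := by
  rw [← four_add_sum_cornerScale]
  refine (Finset.card_union_le _ _).trans (add_le_add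
    (Finset.card_image_le.trans Finset.card_le_four)
    (Finset.card_biUnion_le.trans (Finset.sum_le_sum fun j _ => ?_)))
  exact Finset.card_image_le.trans (Finset.Nat.card_antidiagonal _).le

theorem image_nsmul_outerCells_subset (n k l : ℕ) :
    (cellSize n • ·) '' (l • (outerCells n : Set (ℕ × ℕ))) ⊆
      l • (cellGens n k : Set (ℕ × ℕ)) := by
  refine (Set.image_nsmul (nsmulAddMonoidHom (α := ℕ × ℕ) (cellSize n)) _ _).trans_subset
    (Set.nsmul_subset_nsmul_left ?_)
  rintro _ ⟨c, hc, rfl⟩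
  exact nsmul_mem_cellGens hc

theorem exists_cell_of_mem_cellGens {p : ℕ × ℕ} (hp : p ∈ cellGens n 1) :
    ∃ c d : ℕ × ℕ, cellSize n • c + d = p ∧ c.1 + c.2 = n + 2 ∧
      (c.1 ≤ 1 ∨ n + 1 ≤ c.1 ∨
        ∃ j, n ≤ c.1 + j ∧ 2 * cornerScale n j + cornerScale n j ^ n ≤ d.1 + d.2) := by
  rcases mem_cellGens.1 hp with ⟨c, hc, rfl⟩ | ⟨j, hj, h⟩
  · have h := fst_add_snd_of_mem_outerCells hc
    exact ⟨c, 0, add_zero _, h.1, h.2.imp_right Or.inl⟩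
  · obtain ⟨e, he, rfl⟩ := mem_innerGens.1 h
    refine ⟨(n - j, j + 2), _, rfl, by simp only; omega, Or.inr (Or.inr ⟨j, ?_, ?_⟩)⟩ <;>
      simp only [Prod.fst_add, Prod.snd_add] <;> omega

theorem exists_cell_of_mem_nsmul_cellGens {q : ℕ × ℕ}
    (hq : q ∈ k • (cellGens n 1 : Set (ℕ × ℕ))) :
    ∃ c d : ℕ × ℕ, cellSize n • c + d = q ∧ c.1 + c.2 = k * (n + 2) ∧
      (c.1 ≤ k ∨ n + 1 ≤ c.1 ∨
        ∃ j, n ≤ c.1 + j ∧ 2 * cornerScale n j + cornerScale n j ^ n ≤ d.1 + d.2) := by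
  induction k generalizing q with
  | zero =>
    rw [zero_nsmul, Set.mem_zero] at hq
    exact ⟨0, 0, by simp [hq], by simp, by simp⟩
  | succ k ih =>
    rw [succ_nsmul] at hq
    obtain ⟨q, hq, p, hp, rfl⟩ := hq
    obtain ⟨c, d, rfl, hc, h⟩ := ih hq
    obtain ⟨c', d', rfl, hc', h'⟩ := exists_cell_of_mem_cellGens hp
    refine ⟨c + c', d + d', by rw [nsmul_add, add_add_add_comm], ?_, ?_⟩
    · rw [add_mul]
      simp only [Prod.fst_add, Prod.snd_add]
      omega
    · simp only [Prod.fst_add, Prod.snd_add]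
      rcases h with h | h | ⟨j, h1, h2⟩
      · rcases h' with h' | h' | ⟨j, h1, h2⟩
        · omega
        · omega
        · exact Or.inr (Or.inr ⟨j, by omega, by omega⟩)
      · omega
      · exact Or.inr (Or.inr ⟨j, by omega, by omega⟩)

theorem mem_nsmul_cellGens_or {q : ℕ × ℕ} (hk : k ≠ 0)
    (hq : q ∈ k • (cellGens n 1 : Set (ℕ × ℕ))) :
    q ∈ k • (cellGens n k : Set (ℕ × ℕ)) ∨ ∃ c : ℕ × ℕ, c.1 + c.2 = k * (n + 2) ∧
      cellSize n • c + (cornerScale n (n - k), cornerScale n (n - k)) ≤ q := by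
  obtain ⟨k, rfl⟩ := Nat.exists_eq_add_one_of_ne_zero hk
  refine (mem_succ_nsmul_or (cellGens n (k + 1) : Set (ℕ × ℕ)) hq).imp_right ?_
  rintro ⟨q', hq', p, ⟨hp, hpk⟩, rfl⟩
  obtain ⟨c, d, rfl, hc, -⟩ := exists_cell_of_mem_nsmul_cellGens hq'
  rw [Finset.mem_coe, mem_cellGens] at hp hpk
  obtain ⟨j, hj, h⟩ := hp.resolve_left fun h => hpk (Or.inl h)
  obtain ⟨e, -, rfl⟩ := mem_innerGens.1 h
  have hjk : n - (k + 1) ≤ j := by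
    by_contra hlt
    exact hpk (Or.inr ⟨j, by omega, h⟩)
  have hscale := cornerScale_monotone n hjk
  refine ⟨c + (n - j, j + 2), ?_, ?_⟩
  · rw [Nat.succ_mul]
    simp only [Prod.fst_add, Prod.snd_add]
    omega
  · rw [nsmul_add, add_assoc, add_assoc]
    refine add_le_add_right (le_add_left (add_le_add_right (le_add_right ?_) _)) _
    exact ⟨hscale, hscale⟩

theorem exists_mem_nsmul_cellGens_le {c : ℕ × ℕ} (hk : k ≠ 0) (hc : c.1 + c.2 = k * (n + 2)) :
    ∃ g ∈ k • (cellGens n k : Set (ℕ × ℕ)),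
      g ≤ cellSize n • c + (cornerScale n (n - k), cornerScale n (n - k)) := by
  rcases mem_nsmul_outerCells_or hc with h | ⟨j, c', hj, h, rfl⟩
  · exact ⟨_, image_nsmul_outerCells_subset n k k ⟨c, h, rfl⟩, le_self_add⟩
  obtain ⟨k, rfl⟩ := Nat.exists_eq_add_one_of_ne_zero hk
  have hinner : _ ∈ (cellGens n (k + 1) : Set (ℕ × ℕ)) :=
    mem_cellGens.2 (Or.inr ⟨j, hj, mem_innerGens.2 ⟨(0, cornerScale n j ^ n), zero_add _, rfl⟩⟩)
  have hscale : cornerScale n j + cornerScale n j ^ n < cornerScale n (n - (k + 1)) :=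
    cornerScale_add_pow_lt (by omega)
  have houter := image_nsmul_outerCells_subset n (k + 1) k ⟨c', h, rfl⟩
  refine ⟨_, (succ_nsmul (cellGens n (k + 1) : Set (ℕ × ℕ)) k).symm ▸
    Set.add_mem_add houter hinner, ?_⟩
  rw [nsmul_add, add_assoc]
  gcongr
  constructor <;> simp only [Prod.fst_add, Prod.snd_add] <;> omega

theorem upperClosure_nsmul_cellGens (hk : k ≠ 0) :
    upperClosure (k • (cellGens n 1 : Set (ℕ × ℕ))) =
      upperClosure (k • (cellGens n k : Set (ℕ × ℕ))) := by
  refine le_antisymm (upperClosure_anti (Set.nsmul_subset_nsmul_left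
    (Finset.coe_subset.2 (cellGens_antitone n (Nat.one_le_iff_ne_zero.2 hk))))) ?_
  refine UpperSet.coe_subset_coe.1 (upperClosure_min ?_ (UpperSet.upper _))
  intro q hq
  rw [SetLike.mem_coe, mem_upperClosure]
  rcases mem_nsmul_cellGens_or hk hq with h | ⟨c, hc, hcq⟩
  · exact ⟨q, h, le_rfl⟩
  · obtain ⟨g, hg, hgc⟩ := exists_mem_nsmul_cellGens_le hk hc
    exact ⟨g, hg, hgc.trans hcq⟩

theorem encard_socleSet_cellGens_add_one_le (hk : k ≠ 0) (hkn : k ≤ n) :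
    (socleSet (upperClosure (k • (cellGens n 1 : Set (ℕ × ℕ))))).encard + 1 ≤
      (cornerScale n (n - k) ^ n : ℕ) := by
  have hne : (cellGens n k).Nonempty :=
    ⟨_, nsmul_mem_cellGens (c := (0, n + 2)) (by simp [outerCells])⟩
  have hcard : (k • cellGens n k).card ≤ cornerScale n (n - k) ^ n :=
    calc (k • cellGens n k).card ≤ (cellGens n k).card ^ k := Finset.card_nsmul_le
      _ ≤ cornerScale n (n - k) ^ k := Nat.pow_le_pow_left (card_cellGens_le n k) k
      _ ≤ cornerScale n (n - k) ^ n := Nat.pow_le_pow_right (cornerScale_pos _ _) hkn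
  rw [upperClosure_nsmul_cellGens hk, ← Finset.coe_nsmul]
  exact (encard_socleSet_add_one_le hne.nsmul).trans (by exact_mod_cast hcard)

theorem nsmul_add_notMem_upperClosure {j : ℕ} {c d : ℕ × ℕ} (hcj : c.1 + j = n) (hkc : k < c.1)
    (hc : c.1 + c.2 = k * (n + 2)) (hd1 : d.1 < cellSize n) (hd2 : d.2 < cellSize n)
    (hd : d.1 + d.2 < 2 * cornerScale n j + cornerScale n j ^ n) :
    cellSize n • c + d ∉ upperClosure (k • (cellGens n 1 : Set (ℕ × ℕ))) := by
  intro hmem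
  obtain ⟨_, hq, hle⟩ := mem_upperClosure.1 hmem
  obtain ⟨c', d', rfl, hc', h⟩ := exists_cell_of_mem_nsmul_cellGens hq
  obtain ⟨hle1, hle2⟩ : c'.1 ≤ c.1 ∧ c'.2 ≤ c.2 := le_of_nsmul_add_le hle hd1 hd2
  obtain rfl : c' = c := Prod.ext (by omega) (by omega)
  obtain ⟨hd1', hd2'⟩ : d'.1 ≤ d.1 ∧ d'.2 ≤ d.2 := (add_le_add_iff_left _).1 hle
  obtain ⟨l, hl, hdl⟩ := (h.resolve_left (by omega)).resolve_left (by omega)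
  have hscale : cornerScale n j ≤ cornerScale n l := cornerScale_monotone n (by omega)
  have hpow := Nat.pow_le_pow_left hscale n
  omega

theorem pow_le_encard_socleSet_cellGens (hk : k ≠ 0) (hkn : k < n) :
    ((cornerScale n (n - (k + 1)) ^ n : ℕ) : ℕ∞) ≤
      (socleSet (upperClosure (k • (cellGens n 1 : Set (ℕ × ℕ))))).encard := by
  obtain ⟨k, rfl⟩ := Nat.exists_eq_add_one_of_ne_zero hk
  set j := n - (k + 1 + 1)
  set S := cornerScale n j with hS
  have hlt : S + S ^ n < cellSize n := cornerScale_add_pow_lt (by omega)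
  refine le_encard_socleSet (f := fun i => k • cellSize n • (0, n + 2) +
    (cellSize n • (n - j, j + 2) + ((S, S) + (i, S ^ n - i)))) ?_ ?_
  · intro i hi
    have hinner : _ ∈ innerGens n j :=
      mem_innerGens.2 ⟨(i, S ^ n - i), Nat.add_sub_of_le hi, rfl⟩
    rw [succ_nsmul]
    exact subset_upperClosure (Set.add_mem_add
      (Set.nsmul_mem_nsmul (nsmul_mem_cellGens (by simp [outerCells])))
      (mem_cellGens.2 (Or.inr ⟨j, by omega, hinner⟩)))
  · intro i hi
    have hnotMem : cellSize n • (n - j, k * (n + 2) + (j + 2)) + (S + i, S + (S ^ n - (i + 1))) ∉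
        upperClosure ((k + 1) • (cellGens n 1 : Set (ℕ × ℕ))) := by
      refine nsmul_add_notMem_upperClosure (j := j) ?_ ?_ ?_ ?_ ?_ ?_ <;>
      simp only [add_mul, ← hS] <;>
      omega
    convert hnotMem using 2
    refine Prod.ext (by simp) ?_
    simp only [Prod.smul_mk, smul_eq_mul, Prod.mk_add_mk]
    ring

theorem encard_socleSet_nsmul_cellGens_self (hn : n ≠ 0) :
    (socleSet (upperClosure (n • (cellGens n 1 : Set (ℕ × ℕ))))).encard = (n * (n + 2) : ℕ) := by
  have hcellGens : (cellGens n n : Set (ℕ × ℕ)) =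
      nsmulAddMonoidHom (cellSize n) '' (outerCells n : Set (ℕ × ℕ)) := by
    simp [cellGens]
  rw [upperClosure_nsmul_cellGens hn, hcellGens, ← Set.image_nsmul, nsmul_outerCells_self]
  exact encard_socleSet_nsmul_antidiagonal (cornerScale_pos n n) _

theorem zero_notMem_cellGens (n : ℕ) : 0 ∉ cellGens n 1 := fun h => by
  obtain ⟨c, d, hcd, hc, -⟩ := exists_cell_of_mem_cellGens h
  have hzero : c = 0 :=
    (smul_eq_zero.1 (add_eq_zero.1 hcd).1).resolve_left (cornerScale_pos n n).ne'
  simp [hzero] at hc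

end CellGens

theorem exists_socleType_pow_descending (K : Type*) [Field K] {n : ℕ} (hn : n ≠ 0) :
    ∃ I : Ideal (MvPolynomial (Fin 2) K), IsMonomialIdeal I ∧ I.radical = maxIdealXY K ∧
      (∀ k : ℕ, 1 ≤ k → k < n → socleType (I ^ (k + 1)) < socleType (I ^ k)) ∧
      socleType (I ^ n) = (((n + 1) ^ 2 - 1 : ℕ) : ℕ∞) := by
  have hfst : cellSize n • (n + 2, 0) ∈ cellGens n 1 :=
    nsmul_mem_cellGens (by simp [outerCells])
  have hsnd : cellSize n • (0, n + 2) ∈ cellGens n 1 :=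
    nsmul_mem_cellGens (by simp [outerCells])
  refine ⟨monomialIdeal K (cellGens n 1), isMonomialIdeal_monomialIdeal _,
    radical_monomialIdeal (by simpa using hfst) (by simpa using hsnd) (zero_notMem_cellGens n),
    fun k hk hkn => ?_, ?_⟩ <;>
  simp only [monomialIdeal_pow, socleType_monomialIdeal]
  · have hk' : k ≠ 0 := Nat.one_le_iff_ne_zero.1 hk
    have h := (encard_socleSet_cellGens_add_one_le k.succ_ne_zero hkn).trans
      (pow_le_encard_socleSet_cellGens hk' hkn)
    exact ENat.add_one_le_iff (ne_top_of_le_ne_top (ENat.natCast_ne_top _) (le_self_add.trans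
      (encard_socleSet_cellGens_add_one_le k.succ_ne_zero hkn))) |>.1 h
  · rw [encard_socleSet_nsmul_cellGens_self hn]
    congr 1
    rw [add_sq, mul_one, one_pow, Nat.add_sub_cancel, mul_add, sq, mul_comm n 2]

end Descending

theorem corollary2p8 (K : Type*) [Field K] :
    (∀ I : Ideal (MvPolynomial (Fin 2) K), IsMonomialIdeal I →
      5 ≤ socleType I → 8 ≤ socleType (I ^ 2)) ∧
    (∀ n : ℕ, 1 ≤ n →
      ∃ I : Ideal (MvPolynomial (Fin 2) K), IsMonomialIdeal I ∧ I.radical = maxIdealXY K ∧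
        (∀ k : ℕ, 1 ≤ k → k < n → socleType (I ^ (k + 1)) < socleType (I ^ k)) ∧
        socleType (I ^ n) = (((n + 1) ^ 2 - 1 : ℕ) : ℕ∞)) :=
  ⟨fun _ hI h => eight_le_socleType_sq hI h,
    fun _ hn => exists_socleType_pow_descending K (Nat.one_le_iff_ne_zero.1 hn)⟩
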